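/- Let $X$ be a real normed space. For $x,y\in X$ write $x\perp_B y$ ($x$ is Birkhoff orthogonal to $y$) if $\|x+\lambda y\|\ge\|x\|$ for all $\lambda\in\mathbb{R}$. Call $X$ an inner product space if its norm is induced by an inner product on $X$. (i) $X$ is an inner product space if and only if $$\left\|\frac{x}{\|x\|}-\frac{y}{\|y\|}\right\|\le\frac{2\|x-y\|}{\|x\|+\|y\|}\qquad\text{for all } x,y\in X\setminus\{0\}\text{ with } x\perp_B y.$$ (ii) Suppose $\dim X\ge 2$ (possibly infinite), and let $$DW_B(X)=\sup\left\{\frac{\|x\|+\|y\|}{\|x-y\|}\left\|\frac{x}{\|x\|}-\frac{y}{\|y\|}\right\| : x,y\in X\setminus\{0\},\ x\perp_B y\right\}.$$ Then $X$ is an inner product space if and only if $DW_B(X)=2$. -/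

import Mathlib

/-- `x` is Birkhoff orthogonal to `y`: `‖x + t y‖ ≥ ‖x‖` for every real `t`. -/
def BirkhoffOrthogonal {X : Type*} [NormedAddCommGroup X] [NormedSpace ℝ X] (x y : X) : Prop :=
  ∀ t : ℝ, ‖x‖ ≤ ‖x + t • y‖

/-- The quotient `(‖x‖ + ‖y‖) / ‖x - y‖ * ‖x / ‖x‖ - y / ‖y‖‖`; it is only evaluated at
nonzero `x ≠ y`. -/
noncomputable def dunklWilliamsQuotient {X : Type*} [NormedAddCommGroup X] [NormedSpace ℝ X]
    (x y : X) : ℝ :=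
  (‖x‖ + ‖y‖) / ‖x - y‖ * ‖‖x‖⁻¹ • x - ‖y‖⁻¹ • y‖

/-- The Dunkl-Williams constant `DW_B(X)` for Birkhoff orthogonality: the supremum, in the
extended reals, of the quotient over all pairs of nonzero vectors with `x ⊥_B y`
(such a pair satisfies `x ≠ y`, by taking `t = -1` in the definition of `⊥_B`). -/
noncomputable def DWB (X : Type*) [NormedAddCommGroup X] [NormedSpace ℝ X] : EReal :=
  sSup {r : EReal | ∃ x y : X, x ≠ 0 ∧ y ≠ 0 ∧ BirkhoffOrthogonal x y ∧
    r = ((dunklWilliamsQuotient x y : ℝ) : EReal)}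

/-- The normed space `X` is an inner product space: there is an inner product on the given real
vector space that induces the given norm. -/
def IsInnerProductSpace (X : Type*) [NormedAddCommGroup X] [inst : NormedSpace ℝ X] : Prop :=
  ∃ I : InnerProductSpace ℝ X, I.toNormedSpace = inst

/-!
For unit vectors `x ⊥ y` the Dunkl–Williams inequality gives `x - y ⊥ x + y`, by rescaling `x` and
`y` by `1 + r` and `1 - r` and letting `r → 0`. The parallelogram law involves two vectors, so it
suffices to treat a norm `N` on the plane, with area form `ω`.

Positively oriented unit pairs `x ⊥ y` (frames) form a curve parametrized by the sum of their
angles. Passing to normalized diagonals is a continuous self-map of this curve that increases the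
angle sum by less than `π`, hence it is onto. Every frame thus consists of diagonals of a frame,
and so `⊥` is symmetric on frames. Symmetry makes `ω x y` maximal in each variable separately, so
its increments along the curve are of second order and it is a constant `γ`. Comparing a frame with
its diagonals, and these with their own diagonals, gives `N (x + y) = N (y - x) = √2`. Then
`ω x z ^ 2 + ω y z ^ 2` also has increments of second order, so it is the same for all frames. For
the frame starting at `z / N z` its value is `γ ^ 2 * N z ^ 2`. Hence `N ^ 2` is a quadratic form.

Conversely, in an inner product space the inequality is the Cauchy–Schwarz inequality. Any two unit
vectors `x ⊥ y` give the value `2` of the quotient, and they exist in dimension at least two by the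
Hahn–Banach theorem.
-/

open Filter Topology Complex

section Orthogonality

variable {E : Type*} [AddCommGroup E] [Module ℝ E] {p : Seminorm ℝ E} {x y : E}

/-- Birkhoff orthogonality of `x` to `y` for a seminorm `p`; it lets the norm of a space be pulled
back to the plane. -/
def BirkhoffOrthWith (p : Seminorm ℝ E) (x y : E) : Prop :=
  ∀ t : ℝ, p x ≤ p (x + t • y)

namespace BirkhoffOrthWith

theorem smul (h : BirkhoffOrthWith p x y) (r c : ℝ) : BirkhoffOrthWith p (r • x) (c • y) := by
  intro t
  rcases eq_or_ne r 0 with rfl | hr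
  · simp
  · have factor : r • x + t • c • y = r • (x + (r⁻¹ * (t * c)) • y) := by
      rw [smul_add, smul_smul, smul_smul, ← mul_assoc, mul_inv_cancel₀ hr, one_mul]
    rw [factor, map_smul_eq_mul, map_smul_eq_mul]
    exact mul_le_mul_of_nonneg_left (h _) (norm_nonneg r)

theorem neg_right (h : BirkhoffOrthWith p x y) : BirkhoffOrthWith p x (-y) := by
  simpa using h.smul 1 (-1)

-- By convexity a seminorm that decreases along a line does so at a linear rate, which a quadratic
-- lower bound excludes.
theorem of_forall_one_sub_sq_mul_le (h : ∀ r : ℝ, |r| < 1 → (1 - r ^ 2) * p x ≤ p (x + r • y)) :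
    BirkhoffOrthWith p x y := by
  intro s
  have small : ∀ᶠ l : ℝ in 𝓝[>] 0, (1 - l * s ^ 2) * p x ≤ p (x + s • y) := by
    have lt_one : ∀ᶠ l : ℝ in 𝓝[>] 0, l < 1 ∧ |l * s| < 1 :=
      nhdsWithin_le_nhds <| (eventually_lt_nhds one_pos).and <|
        (Continuous.tendsto' (by fun_prop) 0 0 (by simp)).eventually (eventually_lt_nhds one_pos)
    filter_upwards [lt_one, self_mem_nhdsWithin] with l ⟨hl1, hls⟩ (hl0 : 0 < l)
    have convex : p (x + (l * s) • y) ≤ (1 - l) * p x + l * p (x + s • y) := by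
      have combination : x + (l * s) • y = (1 - l) • x + l • (x + s • y) := by module
      rw [combination]
      refine (map_add_le_add p _ _).trans_eq ?_
      rw [map_smul_eq_mul, map_smul_eq_mul, Real.norm_of_nonneg (sub_nonneg.2 hl1.le),
        Real.norm_of_nonneg hl0.le]
    refine le_of_mul_le_mul_left ?_ hl0
    linarith [h (l * s) hls]
  refine le_of_tendsto ?_ small
  exact (Continuous.tendsto' (by fun_prop) 0 (p x) (by simp)).mono_left nhdsWithin_le_nhds

end BirkhoffOrthWith

/-- The diagonals `x - y` and `x + y` of every pair of unit vectors with `x ⊥ y` satisfy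
`x - y ⊥ x + y`. This is what the Dunkl–Williams inequality says about orthogonal pairs. -/
def HasOrthDiagonals (p : Seminorm ℝ E) : Prop :=
  ∀ ⦃x y : E⦄, p x = 1 → p y = 1 → BirkhoffOrthWith p x y → BirkhoffOrthWith p (x - y) (x + y)

end Orthogonality

section Plane

attribute [local instance] Complex.finrank_real_complex_fact

local notation "ω" => Orientation.areaForm Complex.orientation

theorem areaForm_smul_eq (x y z : ℂ) : ω x y • z = ω z y • x + ω x z • y := by
  apply Complex.ext <;> simp [Complex.areaForm] <;> ring

theorem areaForm_mul_sub_areaForm_mul (x x' y y' : ℂ) :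
    ω x y * ω x' y' - ω x' y * ω x y' = ω x x' * ω y y' := by
  simp only [Complex.areaForm, mul_im, conj_re, conj_im]
  ring

theorem areaForm_add_sub (x y : ℂ) : ω (x + y) (y - x) = 2 * ω x y := by
  rw [map_add, LinearMap.add_apply, map_sub, map_sub, Orientation.areaForm_apply_self,
    Orientation.areaForm_apply_self, Complex.orientation.areaForm_swap y x]
  ring

theorem areaForm_mul_sq_add_sq_sub (x y x' y' z : ℂ) :
    ω x y * (ω x' z ^ 2 + ω y' z ^ 2 - (ω x z ^ 2 + ω y z ^ 2)) =
      2 * (ω x z * ω y z) * (ω x x' - ω y y') - 2 * ω x z ^ 2 * (ω x y - ω x' y) -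
      2 * ω y z ^ 2 * (ω x y - ω x y') + ω x y * (ω (x' - x) z ^ 2 + ω (y' - y) z ^ 2) := by
  simp only [Complex.areaForm, mul_im, conj_re, conj_im, sub_re, sub_im]
  ring

theorem areaForm_exp_exp (α β : ℝ) : ω (Circle.exp α) (Circle.exp β) = Real.sin (β - α) := by
  rw [Complex.areaForm, ← Circle.coe_inv_eq_conj, ← Circle.coe_mul, ← Circle.exp_neg,
    ← Circle.exp_add, Circle.coe_exp, exp_ofReal_mul_I_im, neg_add_eq_sub]

theorem areaForm_exp_smul_mul_smul (τ φ χ r s : ℝ) :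
    ω (Circle.exp τ) (r • (Circle.exp φ : ℂ) * s • (Circle.exp χ : ℂ)) =
      r * s * Real.sin (φ + χ - τ) := by
  rw [smul_mul_smul_comm, ← Circle.coe_mul, ← Circle.exp_add, map_smul, areaForm_exp_exp,
    smul_eq_mul]

theorem areaForm_exp_exp_pos {α β : ℝ} (h : α < β) (h' : β < α + Real.pi) :
    0 < ω (Circle.exp α) (Circle.exp β) := by
  rw [areaForm_exp_exp]
  exact Real.sin_pos_of_pos_of_lt_pi (sub_pos.2 h) (by linarith)

theorem exists_norm_smul_exp_eq {α : ℝ} {z : ℂ} (h : 0 < ω (Circle.exp α) z) :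
    ∃ θ ∈ Set.Ioo α (α + Real.pi), ‖z‖ • (Circle.exp θ : ℂ) = z := by
  have im_pos : 0 < (Circle.exp (-α) * z : ℂ).im := by
    rwa [Complex.areaForm, ← Circle.coe_inv_eq_conj, ← Circle.exp_neg] at h
  set w : ℂ := Circle.exp (-α) * z
  have arg_lt : w.arg < Real.pi :=
    lt_of_le_of_ne (arg_le_pi w) fun h => im_pos.ne' (arg_eq_pi_iff.1 h).2
  have arg_pos : 0 < w.arg :=
    lt_of_le_of_ne (arg_nonneg_iff.2 im_pos.le) fun h => im_pos.ne' (arg_eq_zero_iff.1 h.symm).2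
  refine ⟨α + w.arg, ⟨by linarith, by linarith⟩, ?_⟩
  have norm_w : ‖w‖ = ‖z‖ := by simp [w]
  have polar : ‖w‖ * (Circle.exp w.arg : ℂ) = w := by
    rw [Circle.coe_exp, norm_mul_exp_arg_mul_I]
  rw [real_smul, ← norm_w, Circle.exp_add, Circle.coe_mul, mul_left_comm, polar, ← mul_assoc,
    ← Circle.coe_mul, ← Circle.exp_add, add_neg_cancel, Circle.exp_zero, Circle.coe_one, one_mul]

variable {N : Seminorm ℝ ℂ} {x y x' y' z : ℂ} {α β α' β' : ℝ}

theorem BirkhoffOrthWith.abs_areaForm_mul_le (h : BirkhoffOrthWith N x y) (z : ℂ) :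
    |ω z y| * N x ≤ |ω x y| * N z := by
  rcases eq_or_ne (ω z y) 0 with h0 | h0
  · rw [h0, abs_zero, zero_mul]
    positivity
  · have key : ω z y • (x + (ω x z / ω z y) • y) = ω x y • z := by
      rw [smul_add, smul_smul, mul_div_cancel₀ _ h0, ← areaForm_smul_eq]
    calc |ω z y| * N x ≤ |ω z y| * N (x + (ω x z / ω z y) • y) := by gcongr; exact h _
      _ = |ω x y| * N z := by
        rw [← Real.norm_eq_abs, ← map_smul_eq_mul, key, map_smul_eq_mul, Real.norm_eq_abs]

/-- A positively oriented pair of `N`-unit vectors `x ⊥ y` of the plane. -/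
structure OrthFrame (N : Seminorm ℝ ℂ) (x y : ℂ) : Prop where
  left : N x = 1
  right : N y = 1
  pos : 0 < ω x y
  orth : BirkhoffOrthWith N x y

namespace OrthFrame

theorem abs_areaForm_le (h : OrthFrame N x y) (z : ℂ) : |ω z y| ≤ ω x y * N z := by
  simpa only [h.left, abs_of_pos h.pos, mul_one] using h.orth.abs_areaForm_mul_le z

theorem one_le_add (h : OrthFrame N x y) : 1 ≤ N (x + y) := by
  simpa [h.left] using h.orth 1

theorem one_le_sub (h : OrthFrame N x y) : 1 ≤ N (y - x) := by
  simpa [h.left, ← sub_eq_add_neg, map_sub_rev] using h.orth (-1)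

theorem norm_add_pos (h : OrthFrame N x y) : 0 < ‖x + y‖ :=
  norm_pos_iff.2 fun h0 => by linarith [h.one_le_add, h0 ▸ map_zero N]

theorem norm_sub_pos (h : OrthFrame N x y) : 0 < ‖y - x‖ :=
  norm_pos_iff.2 fun h0 => by linarith [h.one_le_sub, h0 ▸ map_zero N]

theorem diagonals (hd : HasOrthDiagonals N) (h : OrthFrame N x y) :
    OrthFrame N ((N (x + y))⁻¹ • (x + y)) ((N (y - x))⁻¹ • (y - x)) where
  left := by
    rw [map_smul_eq_mul, Real.norm_of_nonneg (by positivity),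
      inv_mul_cancel₀ (by linarith [h.one_le_add])]
  right := by
    rw [map_smul_eq_mul, Real.norm_of_nonneg (by positivity),
      inv_mul_cancel₀ (by linarith [h.one_le_sub])]
  pos := by
    have := h.pos
    have := h.one_le_add
    have := h.one_le_sub
    rw [map_smul, map_smul, LinearMap.smul_apply, areaForm_add_sub, smul_eq_mul, smul_eq_mul]
    positivity
  orth := by
    have orth_neg := hd h.left ((map_neg_eq_map N y).trans h.right) h.orth.neg_right
    rw [sub_neg_eq_add, ← sub_eq_add_neg] at orth_neg
    simpa using (orth_neg.neg_right).smul (N (x + y))⁻¹ (N (y - x))⁻¹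

end OrthFrame

/-- Angles `α < β < α + π` of two directions with `exp (i α) ⊥ exp (i β)`: the angular coordinates
of an `OrthFrame`. -/
structure OrthAngles (N : Seminorm ℝ ℂ) (α β : ℝ) : Prop where
  lt : α < β
  lt_add_pi : β < α + Real.pi
  orth : BirkhoffOrthWith N (Circle.exp α) (Circle.exp β)

namespace OrthAngles

theorem mono (hN : ∀ z, z ≠ 0 → 0 < N z) (h : OrthAngles N α β) (h' : OrthAngles N α' β')
    (hlt : α < α') : β ≤ β' := by
  by_contra! hb
  have := h.lt
  have := h.lt_add_pi
  have := h'.lt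
  have := h'.lt_add_pi
  have pos : 0 < ω (Circle.exp α) (Circle.exp β) := areaForm_exp_exp_pos h.lt h.lt_add_pi
  have pos' : 0 < ω (Circle.exp α') (Circle.exp β') := areaForm_exp_exp_pos h'.lt h'.lt_add_pi
  have cross : 0 < ω (Circle.exp α') (Circle.exp β) :=
    areaForm_exp_exp_pos (by linarith) (by linarith)
  have cross' : 0 < ω (Circle.exp α) (Circle.exp β') :=
    areaForm_exp_exp_pos (by linarith) (by linarith)
  have lefts : 0 < ω (Circle.exp α) (Circle.exp α') :=
    areaForm_exp_exp_pos (by linarith) (by linarith)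
  have rights : 0 < ω (Circle.exp β') (Circle.exp β) :=
    areaForm_exp_exp_pos (by linarith) (by linarith)
  have hα := hN _ (Circle.exp α).coe_ne_zero
  have hα' := hN _ (Circle.exp α').coe_ne_zero
  have orth := h.orth.abs_areaForm_mul_le (Circle.exp α')
  have orth' := h'.orth.abs_areaForm_mul_le (Circle.exp α)
  rw [abs_of_pos pos, abs_of_pos cross] at orth
  rw [abs_of_pos pos', abs_of_pos cross'] at orth'
  have cross_le : ω (Circle.exp α') (Circle.exp β) * ω (Circle.exp α) (Circle.exp β') ≤
      ω (Circle.exp α) (Circle.exp β) * ω (Circle.exp α') (Circle.exp β') := by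
    refine le_of_mul_le_mul_right ?_ (mul_pos hα hα')
    linarith [mul_le_mul orth orth' (mul_pos cross' hα').le (mul_pos pos hα').le]
  have identity := areaForm_mul_sub_areaForm_mul (Circle.exp α) (Circle.exp α') (Circle.exp β)
    (Circle.exp β')
  rw [Complex.orientation.areaForm_swap (Circle.exp β)] at identity
  linarith [mul_pos lefts rights]

theorem le_of_add_le (hN : ∀ z, z ≠ 0 → 0 < N z) (h : OrthAngles N α β)
    (h' : OrthAngles N α' β') (hle : α + β ≤ α' + β') : α ≤ α' ∧ β ≤ β' := by
  have left_le : α ≤ α' := by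
    by_contra! hlt
    linarith [h'.mono hN h hlt]
  rcases left_le.lt_or_eq with hlt | rfl
  · exact ⟨left_le, h.mono hN h' hlt⟩
  · exact ⟨le_rfl, by linarith⟩

theorem unique (hN : ∀ z, z ≠ 0 → 0 < N z) (h : OrthAngles N α β) (h' : OrthAngles N α' β')
    (heq : α + β = α' + β') : α = α' ∧ β = β' := by
  have le := h.le_of_add_le hN h' heq.le
  have ge := h'.le_of_add_le hN h heq.ge
  exact ⟨le.1.antisymm ge.1, le.2.antisymm ge.2⟩

theorem lipschitzWith {α β : ℝ → ℝ} (hN : ∀ z, z ≠ 0 → 0 < N z)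
    (h : ∀ t, OrthAngles N (α t) (β t)) (hsum : ∀ t, α t + β t = t) :
    LipschitzWith 1 α ∧ LipschitzWith 1 β := by
  have mono : ∀ s t, s ≤ t → α s ≤ α t ∧ β s ≤ β t := fun s t hst =>
    (h s).le_of_add_le hN (h t) (by rwa [hsum, hsum])
  refine ⟨.of_le_add fun s t => ?_, .of_le_add fun s t => ?_⟩ <;>
  · rw [Real.dist_eq]
    have := hsum s
    have := hsum t
    rcases le_total s t with hst | hts
    · linarith [mono s t hst, abs_nonneg (s - t)]
    · linarith [mono t s hts, le_abs_self (s - t)]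

end OrthAngles

theorem im_exp_mul_conj_smul_exp_sq (t r θ : ℝ) :
    (Circle.exp t * (starRingEnd ℂ) (r • (Circle.exp θ : ℂ)) ^ 2).im =
      r ^ 2 * Real.sin (t - 2 * θ) := by
  have h : (Circle.exp t : ℂ) * ((r : ℂ) * (Circle.exp (-θ) : ℂ)) ^ 2 = (r ^ 2 : ℝ) *
      (Circle.exp (t - 2 * θ) : ℂ) := by
    rw [show t - 2 * θ = t + (-θ + -θ) by ring]
    simp only [Circle.exp_add, Circle.coe_mul]
    push_cast
    ring
  rw [real_smul, map_mul, conj_ofReal, ← Circle.coe_inv_eq_conj, ← Circle.exp_neg, h, im_ofReal_mul,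
    Circle.coe_exp, exp_ofReal_mul_I_im]

theorem im_exp_mul_conj_exp_add_smul_exp_sq (α β s : ℝ) :
    (Circle.exp (α + β) * (starRingEnd ℂ) (Circle.exp α + s • (Circle.exp β : ℂ)) ^ 2).im =
      (1 - s ^ 2) * Real.sin (β - α) := by
  have expand : (Circle.exp (α + β) : ℂ) *
      (starRingEnd ℂ) (Circle.exp α + s • (Circle.exp β : ℂ)) ^ 2 =
      Circle.exp (β - α) + (2 * s : ℝ) + (s ^ 2 : ℝ) * Circle.exp (α - β) := by
    rw [Circle.exp_add, Circle.exp_sub, Circle.exp_sub, map_add, real_smul, map_mul, conj_ofReal,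
      ← Circle.coe_inv_eq_conj, ← Circle.coe_inv_eq_conj]
    simp only [Circle.coe_mul, Circle.coe_inv, Circle.coe_div]
    have := (Circle.exp α).coe_ne_zero
    have := (Circle.exp β).coe_ne_zero
    push_cast
    field_simp
    ring
  rw [expand, add_im, add_im, ofReal_im, im_ofReal_mul, Circle.coe_exp, Circle.coe_exp,
    exp_ofReal_mul_I_im, exp_ofReal_mul_I_im, ← neg_sub, Real.sin_neg]
  ring

theorem exists_forall_sin_mul_sq_le (hN : ∀ z, z ≠ 0 → 0 < N z) (t : ℝ) :
    ∃ α, 0 < t - 2 * α ∧ t - 2 * α < Real.pi ∧ ∀ θ, Real.sin (t - 2 * θ) * N (Circle.exp α) ^ 2 ≤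
      Real.sin (t - 2 * α) * N (Circle.exp θ) ^ 2 := by
  have norm_pos : ∀ θ, 0 < N (Circle.exp θ) := fun θ => hN _ (Circle.exp θ).coe_ne_zero
  set f : ℝ → ℝ := fun θ => Real.sin (t - 2 * θ) / N (Circle.exp θ) ^ 2
  have continuous_f : Continuous f := by
    have := N.convexOn.locallyLipschitz.continuous
    exact .div (by fun_prop) (by fun_prop) fun θ => (pow_pos (norm_pos θ) 2).ne'
  have periodic_f : Function.Periodic f Real.pi := fun θ => by
    have exp_pi : (Circle.exp Real.pi : ℂ) = -1 := by rw [Circle.coe_exp, exp_pi_mul_I]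
    simp only [f, Circle.exp_add, Circle.coe_mul, exp_pi, mul_neg_one, map_neg_eq_map, mul_add,
      ← sub_sub, Real.sin_sub_two_pi]
  obtain ⟨α, hα, hmax⟩ : ∃ α ∈ Set.Icc ((t - Real.pi) / 2) ((t + Real.pi) / 2), IsMaxOn f _ α :=
    isCompact_Icc.exists_isMaxOn (Set.nonempty_Icc.2 (by linarith [Real.pi_pos]))
      continuous_f.continuousOn
  have le_max : ∀ θ, f θ ≤ f α := by
    intro θ
    obtain ⟨θ', hθ', h⟩ := periodic_f.exists_mem_Ico Real.pi_pos θ ((t - Real.pi) / 2)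
    exact h ▸ hmax ⟨hθ'.1, by linarith [hθ'.2]⟩
  have sin_pos : 0 < Real.sin (t - 2 * α) := by
    have sin_eq_one : Real.sin (t - 2 * ((t - Real.pi / 2) / 2)) = 1 := by
      rw [mul_div_cancel₀ _ two_ne_zero, sub_sub_cancel, Real.sin_pi_div_two]
    have value_pos : 0 < f ((t - Real.pi / 2) / 2) := by
      simp only [f, sin_eq_one]
      exact one_div_pos.2 (pow_pos (norm_pos _) 2)
    exact (div_pos_iff_of_pos_right (pow_pos (norm_pos α) 2)).1 (value_pos.trans_le (le_max _))
  refine ⟨α, ?_, ?_, fun θ => ?_⟩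
  · by_contra! h
    exact sin_pos.not_ge (Real.sin_nonpos_of_nonpos_of_neg_pi_le h (by linarith [hα.2]))
  · refine lt_of_le_of_ne (by linarith [hα.1]) fun h => ?_
    rw [h, Real.sin_pi] at sin_pos
    exact lt_irrefl _ sin_pos
  · exact (div_le_div_iff₀ (pow_pos (norm_pos θ) 2) (pow_pos (norm_pos α) 2)).1 (le_max θ)

-- The direction `α` maximizing `sin (t - 2 θ) / N (exp θ) ^ 2` works because the quadratic form
-- `‖z‖² sin (t - 2 arg z)` equals `(1 - s²) sin (t - 2 α)` at `z = exp α + s exp (t - α)`.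
theorem exists_orthAngles (hN : ∀ z, z ≠ 0 → 0 < N z) (t : ℝ) :
    ∃ α β, OrthAngles N α β ∧ α + β = t := by
  obtain ⟨α, pos, lt_pi, le_max⟩ := exists_forall_sin_mul_sq_le hN t
  refine ⟨α, t - α, ⟨by linarith, by linarith, ?_⟩, by ring⟩
  refine .of_forall_one_sub_sq_mul_le fun s hs => ?_
  set z : ℂ := Circle.exp α + s • (Circle.exp (t - α) : ℂ)
  have polar : ‖z‖ • (Circle.exp z.arg : ℂ) = z := by
    rw [real_smul, Circle.coe_exp, norm_mul_exp_arg_mul_I]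
  have form_eq : (1 - s ^ 2) * Real.sin (t - 2 * α) = ‖z‖ ^ 2 * Real.sin (t - 2 * z.arg) := by
    have h := im_exp_mul_conj_exp_add_smul_exp_sq α (t - α) s
    rw [add_sub_cancel, show t - α - α = t - 2 * α by ring] at h
    rw [← h, ← im_exp_mul_conj_smul_exp_sq, polar]
  have sq_le : (1 - s ^ 2) * N (Circle.exp α) ^ 2 ≤ N z ^ 2 := by
    have norm_z : N z = ‖z‖ * N (Circle.exp z.arg) := by
      rw [← norm_norm z, ← map_smul_eq_mul, polar]
    refine le_of_mul_le_mul_left ?_ (Real.sin_pos_of_pos_of_lt_pi pos lt_pi)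
    calc Real.sin (t - 2 * α) * ((1 - s ^ 2) * N (Circle.exp α) ^ 2)
        = ‖z‖ ^ 2 * (Real.sin (t - 2 * z.arg) * N (Circle.exp α) ^ 2) := by
          linear_combination N (Circle.exp α) ^ 2 * form_eq
      _ ≤ ‖z‖ ^ 2 * (Real.sin (t - 2 * α) * N (Circle.exp z.arg) ^ 2) := by
          exact mul_le_mul_of_nonneg_left (le_max _) (sq_nonneg _)
      _ = Real.sin (t - 2 * α) * N z ^ 2 := by rw [norm_z]; ring
  have one_sub_sq_nonneg : 0 ≤ 1 - s ^ 2 := sub_nonneg.2 (sq_le_one_iff_abs_le_one s |>.2 hs.le)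
  refine le_of_sq_le_sq ?_ (apply_nonneg N z)
  calc ((1 - s ^ 2) * N (Circle.exp α)) ^ 2
      = (1 - s ^ 2) * ((1 - s ^ 2) * N (Circle.exp α) ^ 2) := by ring
    _ ≤ 1 * ((1 - s ^ 2) * N (Circle.exp α) ^ 2) := by
        gcongr
        exact sub_le_self 1 (sq_nonneg s)
    _ ≤ N z ^ 2 := (one_mul _).trans_le sq_le

/-- The `N`-unit vector in the direction `exp (i θ)`. -/
noncomputable def unitDir (N : Seminorm ℝ ℂ) (θ : ℝ) : ℂ :=
  (N (Circle.exp θ))⁻¹ • (Circle.exp θ : ℂ)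

theorem unitDir_eq_inv_smul {r θ : ℝ} (hr : 0 < r) (hz : r • (Circle.exp θ : ℂ) = z) :
    unitDir N θ = (N z)⁻¹ • z := by
  rw [← hz, map_smul_eq_mul, Real.norm_of_nonneg hr.le, smul_smul, mul_inv_rev,
    inv_mul_cancel_right₀ hr.ne', unitDir]

theorem seminorm_unitDir (hN : ∀ z, z ≠ 0 → 0 < N z) (θ : ℝ) : N (unitDir N θ) = 1 := by
  have h := hN _ (Circle.exp θ).coe_ne_zero
  rw [unitDir, map_smul_eq_mul, Real.norm_of_nonneg (inv_pos.2 h).le, inv_mul_cancel₀ h.ne']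

theorem unitDir_arg (hz : z ≠ 0) : unitDir N z.arg = (N z)⁻¹ • z :=
  unitDir_eq_inv_smul (norm_pos_iff.2 hz) <| by
    rw [real_smul, Circle.coe_exp, norm_mul_exp_arg_mul_I]

theorem lipschitzWith_exp : LipschitzWith 1 fun θ : ℝ => (Circle.exp θ : ℂ) := by
  refine .of_dist_le_mul fun s t => ?_
  have factor : (Circle.exp s : ℂ) - Circle.exp t =
      Circle.exp t * (Complex.exp (I * (s - t : ℝ)) - 1) := by
    rw [mul_sub_one, mul_comm I, ← Circle.coe_exp, ← Circle.coe_mul, ← Circle.exp_add,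
      add_sub_cancel]
  rw [dist_eq_norm, factor, norm_mul, Circle.norm_coe, one_mul, NNReal.coe_one, one_mul]
  exact Real.norm_exp_I_mul_ofReal_sub_one_le

theorem exists_pos_forall_le_circle (hN : ∀ z, z ≠ 0 → 0 < N z) :
    ∃ m, 0 < m ∧ ∀ w : Circle, m ≤ N w := by
  have : Continuous N := N.convexOn.locallyLipschitz.continuous
  obtain ⟨w₀, -, hmin⟩ := isCompact_univ.exists_isMinOn (Set.univ_nonempty (α := Circle))
    (f := fun w : Circle => N w) (by fun_prop)
  exact ⟨N w₀, hN _ w₀.coe_ne_zero, fun w => hmin (Set.mem_univ w)⟩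

theorem exists_lipschitzWith_unitDir (hN : ∀ z, z ≠ 0 → 0 < N z) :
    ∃ K, LipschitzWith K (unitDir N) := by
  obtain ⟨m, hm, le_norm⟩ := exists_pos_forall_le_circle hN
  obtain ⟨C, hC, norm_le⟩ :=
    N.bound_of_continuous_normedSpace N.convexOn.locallyLipschitz.continuous
  refine ⟨(m⁻¹ + C * m⁻¹ * m⁻¹).toNNReal, .of_dist_le_mul fun s t => ?_⟩
  set u := Circle.exp s
  set v := Circle.exp t
  have dist_le : ‖(u : ℂ) - v‖ ≤ dist s t := by
    rw [← dist_eq_norm]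
    simpa only [NNReal.coe_one, one_mul] using lipschitzWith_exp.dist_le_mul s t
  have inv_sub_le : |(N u)⁻¹ - (N v)⁻¹| ≤ C * m⁻¹ * m⁻¹ * dist s t := by
    have diff_le : |N v - N u| ≤ C * dist s t := by
      refine (abs_sub_map_le_sub N _ _).trans ((norm_le _).trans ?_)
      rw [norm_sub_rev]
      gcongr
    rw [inv_sub_inv (hN _ u.coe_ne_zero).ne' (hN _ v.coe_ne_zero).ne', div_eq_mul_inv, mul_inv,
      abs_mul, abs_of_nonneg (by positivity : 0 ≤ (N u)⁻¹ * (N v)⁻¹)]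
    calc |N v - N u| * ((N u)⁻¹ * (N v)⁻¹) ≤ C * dist s t * (m⁻¹ * m⁻¹) := by
          gcongr <;> exact le_norm _
      _ = C * m⁻¹ * m⁻¹ * dist s t := by ring
  have split : unitDir N s - unitDir N t =
      (N u)⁻¹ • ((u : ℂ) - v) + ((N u)⁻¹ - (N v)⁻¹) • (v : ℂ) := by
    simp only [unitDir, u, v]
    module
  calc dist (unitDir N s) (unitDir N t)
      ≤ (N u)⁻¹ * ‖(u : ℂ) - v‖ + |(N u)⁻¹ - (N v)⁻¹| := by
        rw [dist_eq_norm, split]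
        refine (norm_add_le _ _).trans_eq ?_
        rw [norm_smul, norm_smul, Circle.norm_coe, mul_one, Real.norm_of_nonneg (by positivity),
          Real.norm_eq_abs]
    _ ≤ m⁻¹ * dist s t + C * m⁻¹ * m⁻¹ * dist s t := by
        gcongr
        exact le_norm u
    _ = (m⁻¹ + C * m⁻¹ * m⁻¹).toNNReal * dist s t := by
        rw [Real.coe_toNNReal _ (by positivity)]
        ring

theorem OrthAngles.orthFrame (hN : ∀ z, z ≠ 0 → 0 < N z) (h : OrthAngles N α β) :
    OrthFrame N (unitDir N α) (unitDir N β) where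
  left := seminorm_unitDir hN α
  right := seminorm_unitDir hN β
  pos := by
    have := hN _ (Circle.exp α).coe_ne_zero
    have := hN _ (Circle.exp β).coe_ne_zero
    have := areaForm_exp_exp_pos h.lt h.lt_add_pi
    rw [unitDir, unitDir, map_smul, map_smul, LinearMap.smul_apply, smul_eq_mul, smul_eq_mul]
    positivity
  orth := h.orth.smul _ _

theorem areaForm_unitDir_pos_iff (hN : ∀ z, z ≠ 0 → 0 < N z) :
    0 < ω (unitDir N α) z ↔ 0 < ω (Circle.exp α) z := by
  rw [unitDir, map_smul, LinearMap.smul_apply, smul_eq_mul,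
    mul_pos_iff_of_pos_left (inv_pos.2 (hN _ (Circle.exp α).coe_ne_zero))]

theorem OrthFrame.orthAngles (hN : ∀ z, z ≠ 0 → 0 < N z)
    (h : OrthFrame N (unitDir N α) (unitDir N β)) (lt : α < β) (lt_add_pi : β < α + Real.pi) :
    OrthAngles N α β := by
  refine ⟨lt, lt_add_pi, ?_⟩
  rw [← smul_inv_smul₀ (hN _ (Circle.exp α).coe_ne_zero).ne' (Circle.exp α : ℂ),
    ← smul_inv_smul₀ (hN _ (Circle.exp β).coe_ne_zero).ne' (Circle.exp β : ℂ)]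
  exact h.orth.smul _ _

theorem OrthFrame.exists_angles (hN : ∀ z, z ≠ 0 → 0 < N z) (h : OrthFrame N x y) :
    ∃ α β, OrthAngles N α β ∧ unitDir N α = x ∧ unitDir N β = y := by
  obtain ⟨α, rfl⟩ : ∃ α, unitDir N α = x := by
    have x_ne_zero : x ≠ 0 := fun h0 => by simpa [h0] using h.left
    exact ⟨x.arg, by rw [unitDir_arg x_ne_zero, h.left, inv_one, one_smul]⟩
  obtain ⟨β, ⟨lt, lt_add_pi⟩, polar⟩ :=
    exists_norm_smul_exp_eq ((areaForm_unitDir_pos_iff hN).1 h.pos)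
  have norm_pos : 0 < ‖y‖ := norm_pos_iff.2 fun h0 => by simpa [h0] using h.pos
  obtain rfl : unitDir N β = y := by
    rw [unitDir_eq_inv_smul norm_pos polar, h.right, inv_one, one_smul]
  exact ⟨α, β, h.orthAngles hN lt lt_add_pi, rfl, rfl⟩

theorem exists_orthFrame_left (hN : ∀ z, z ≠ 0 → 0 < N z) (hz : z ≠ 0) :
    ∃ y, OrthFrame N ((N z)⁻¹ • z) y := by
  choose α β angles sum_eq using exists_orthAngles hN
  have lower : ∀ t, (t - Real.pi) / 2 ≤ α t := fun t => by
    linarith [sum_eq t, (angles t).lt_add_pi]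
  have upper : ∀ t, α t ≤ t / 2 := fun t => by linarith [sum_eq t, (angles t).lt]
  have surjective : Function.Surjective α :=
    (OrthAngles.lipschitzWith hN angles sum_eq).1.continuous.surjective
      (tendsto_atTop_mono lower
        ((tendsto_atTop_add_const_right _ _ tendsto_id).atTop_div_const two_pos))
      (tendsto_atBot_mono upper (tendsto_id.atBot_div_const two_pos))
  obtain ⟨t, ht⟩ := surjective z.arg
  exact ⟨_, unitDir_arg hz ▸ ht ▸ (angles t).orthFrame hN⟩

theorem eq_of_forall_abs_sub_le_sq {f : ℝ → ℝ} (h : ∀ t, ∃ C, ∀ s, |f s - f t| ≤ C * (s - t) ^ 2)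
    (s t : ℝ) : f s = f t := by
  have deriv_zero : ∀ t, HasDerivAt f 0 t := fun t => by
    obtain ⟨C, hC⟩ := h t
    have isBigO : (fun s => f s - f t) =O[𝓝 t] fun s => ‖s - t‖ ^ 2 :=
      .of_bound C <| .of_forall fun s => by simpa using hC s
    have hasFDerivAt : HasFDerivAt (fun s => f s - f t) (0 : ℝ →L[ℝ] ℝ) t :=
      isBigO.hasFDerivAt one_lt_two
    simpa using hasFDerivAt.hasDerivAt.add_const (f t)
  exact is_const_of_deriv_eq_zero (fun t => (deriv_zero t).differentiableAt)
    (fun t => (deriv_zero t).deriv) s t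

-- Frames form a Lipschitz curve, parametrized by the sum of their angles, along which `F` has
-- derivative zero.
theorem OrthFrame.eq_of_abs_sub_le_sq (hN : ∀ z, z ≠ 0 → 0 < N z) {F : ℂ → ℂ → ℝ}
    (hF : ∀ x y, OrthFrame N x y → ∃ C, ∀ x' y', OrthFrame N x' y' →
      |F x' y' - F x y| ≤ C * (‖x' - x‖ + ‖y' - y‖) ^ 2)
    (h : OrthFrame N x y) (h' : OrthFrame N x' y') : F x y = F x' y' := by
  choose α β angles sum_eq using exists_orthAngles hN
  obtain ⟨K, lipschitz⟩ := exists_lipschitzWith_unitDir hN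
  obtain ⟨lip_α, lip_β⟩ := OrthAngles.lipschitzWith hN angles sum_eq
  have const : ∀ s t, F (unitDir N (α s)) (unitDir N (β s)) =
      F (unitDir N (α t)) (unitDir N (β t)) := by
    refine eq_of_forall_abs_sub_le_sq
      (f := fun t => F (unitDir N (α t)) (unitDir N (β t))) fun t => ?_
    obtain ⟨C, hC⟩ := hF _ _ ((angles t).orthFrame hN)
    refine ⟨|C| * (2 * K) ^ 2, fun s => (hC _ _ ((angles s).orthFrame hN)).trans ?_⟩
    have le_α := (lipschitz.comp lip_α).dist_le_mul s t
    have le_β := (lipschitz.comp lip_β).dist_le_mul s t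
    simp only [mul_one, dist_eq_norm, Real.norm_eq_abs, Function.comp_apply] at le_α le_β
    calc _ ≤ |C| * (K * |s - t| + K * |s - t|) ^ 2 := by
          gcongr
          exact le_abs_self C
      _ = |C| * (2 * K) ^ 2 * (s - t) ^ 2 := by rw [← sq_abs (s - t)]; ring
  obtain ⟨a, b, hab, rfl, rfl⟩ := h.exists_angles hN
  obtain ⟨a', b', hab', rfl, rfl⟩ := h'.exists_angles hN
  obtain ⟨ha, hb⟩ := (angles (a + b)).unique hN hab (sum_eq _)
  obtain ⟨ha', hb'⟩ := (angles (a' + b')).unique hN hab' (sum_eq _)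
  simpa only [ha, hb, ha', hb'] using const (a + b) (a' + b')

theorem lt_of_areaForm_unitDir_pos (hN : ∀ z, z ≠ 0 → 0 < N z) (hle : α ≤ β + Real.pi)
    (pos : 0 < ω (unitDir N α) (unitDir N β)) : α < β := by
  rw [areaForm_unitDir_pos_iff hN, unitDir, map_smul, smul_eq_mul,
    mul_pos_iff_of_pos_left (inv_pos.2 (hN _ (Circle.exp β).coe_ne_zero)), areaForm_exp_exp] at pos
  by_contra! hβα
  exact pos.not_ge (Real.sin_nonpos_of_nonpos_of_neg_pi_le (by linarith) (by linarith))

theorem OrthAngles.exists_diagonals (hN : ∀ z, z ≠ 0 → 0 < N z) (hd : HasOrthDiagonals N)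
    (h : OrthAngles N α β) (hx : unitDir N α = x) (hy : unitDir N β = y) :
    ∃ φ χ, OrthAngles N φ χ ∧ ‖x + y‖ • (Circle.exp φ : ℂ) = x + y ∧
      ‖y - x‖ • (Circle.exp χ : ℂ) = y - x ∧ φ + χ ∈ Set.Ioo (α + β) (α + β + Real.pi) := by
  have frame : OrthFrame N x y := hx ▸ hy ▸ h.orthFrame hN
  have area_pos := frame.pos
  have add_pos : 0 < N (x + y) := one_pos.trans_le frame.one_le_add
  have sub_pos : 0 < N (y - x) := one_pos.trans_le frame.one_le_sub
  have := h.lt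
  have := h.lt_add_pi
  obtain ⟨φ, ⟨lt_φ, φ_lt⟩, polar_add⟩ : ∃ φ ∈ Set.Ioo α (α + Real.pi),
      ‖x + y‖ • (Circle.exp φ : ℂ) = x + y := exists_norm_smul_exp_eq <| by
    rwa [← areaForm_unitDir_pos_iff hN, hx, map_add, Orientation.areaForm_apply_self, zero_add]
  obtain ⟨χ, ⟨lt_χ, χ_lt⟩, polar_sub⟩ : ∃ χ ∈ Set.Ioo α (α + Real.pi),
      ‖y - x‖ • (Circle.exp χ : ℂ) = y - x := exists_norm_smul_exp_eq <| by
    rwa [← areaForm_unitDir_pos_iff hN, hx, map_sub, Orientation.areaForm_apply_self, sub_zero]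
  have unitDir_φ := unitDir_eq_inv_smul (N := N) frame.norm_add_pos polar_add
  have unitDir_χ := unitDir_eq_inv_smul (N := N) frame.norm_sub_pos polar_sub
  have φ_lt_β : φ < β := by
    refine lt_of_areaForm_unitDir_pos hN (by linarith) ?_
    rw [unitDir_φ, hy, map_smul, LinearMap.smul_apply, map_add ω, LinearMap.add_apply,
      Orientation.areaForm_apply_self, add_zero]
    positivity
  have β_lt_χ : β < χ := by
    refine lt_of_areaForm_unitDir_pos hN (by linarith) ?_
    rw [unitDir_χ, hy, map_smul, map_sub (ω y), Orientation.areaForm_apply_self, zero_sub,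
      ← Orientation.areaForm_swap]
    positivity
  refine ⟨φ, χ, ?_, polar_add, polar_sub, by linarith, by linarith⟩
  refine OrthFrame.orthAngles hN ?_ (by linarith) (by linarith)
  rw [unitDir_φ, unitDir_χ]
  exact frame.diagonals hd

-- The angle sum of the diagonals exceeds that of the frame by less than `π`, so the intermediate
-- value theorem applies.
theorem exists_orthAngles_diagonals (hN : ∀ z, z ≠ 0 → 0 < N z) (hd : HasOrthDiagonals N) (τ : ℝ) :
    ∃ x y φ χ, OrthFrame N x y ∧ OrthAngles N φ χ ∧ ‖x + y‖ • (Circle.exp φ : ℂ) = x + y ∧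
      ‖y - x‖ • (Circle.exp χ : ℂ) = y - x ∧ φ + χ = τ := by
  choose α β angles sum_eq using exists_orthAngles hN
  choose φ χ diag polar_add polar_sub sum_mem using fun t =>
    (angles t).exists_diagonals hN hd rfl rfl
  simp only [sum_eq] at sum_mem
  set x := fun t => unitDir N (α t)
  set y := fun t => unitDir N (β t)
  have frame : ∀ t, OrthFrame N (x t) (y t) := fun t => (angles t).orthFrame hN
  obtain ⟨K, lipschitz⟩ := exists_lipschitzWith_unitDir hN
  obtain ⟨lip_α, lip_β⟩ := OrthAngles.lipschitzWith hN angles sum_eq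
  have continuous_x : Continuous x := lipschitz.continuous.comp lip_α.continuous
  have continuous_y : Continuous y := lipschitz.continuous.comp lip_β.continuous
  set f : ℝ → ℝ := fun t => ω (Circle.exp τ) ((x t + y t) * (y t - x t))
  have continuous_f : Continuous f := by
    simp only [f, Complex.areaForm]
    fun_prop
  have f_eq : ∀ t, f t = ‖x t + y t‖ * ‖y t - x t‖ * Real.sin (φ t + χ t - τ) := fun t => by
    rw [← areaForm_exp_smul_mul_smul, polar_add, polar_sub]
  have f_nonpos : f (τ - Real.pi) ≤ 0 := by
    have ⟨lower, upper⟩ := sum_mem (τ - Real.pi)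
    exact (f_eq _).trans_le <| mul_nonpos_of_nonneg_of_nonpos (by positivity)
      (Real.sin_nonpos_of_nonpos_of_neg_pi_le (by linarith) (by linarith))
  have f_nonneg : 0 ≤ f τ := by
    have ⟨lower, upper⟩ := sum_mem τ
    exact le_of_le_of_eq (mul_nonneg (by positivity)
      (Real.sin_nonneg_of_nonneg_of_le_pi (by linarith) (by linarith))) (f_eq _).symm
  obtain ⟨t, ⟨le_t, t_le⟩, root⟩ : (0 : ℝ) ∈ f '' Set.Icc (τ - Real.pi) τ :=
    intermediate_value_Icc (by linarith [Real.pi_pos]) continuous_f.continuousOn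
      ⟨f_nonpos, f_nonneg⟩
  refine ⟨x t, y t, φ t, χ t, frame t, diag t, polar_add t, polar_sub t, ?_⟩
  have ⟨lower, upper⟩ := sum_mem t
  rw [f_eq, mul_eq_zero_iff_left (mul_pos (frame t).norm_add_pos (frame t).norm_sub_pos).ne',
    Real.sin_eq_zero_iff_of_lt_of_lt (by linarith) (by linarith)] at root
  exact sub_eq_zero.1 root

theorem abs_two_mul_sub_sub_le {X Y e e' δ : ℝ} (he : 0 ≤ e) (he' : 0 ≤ e') (hδ : |δ| ≤ e + e') :
    |2 * (X * Y) * δ - 2 * X ^ 2 * e - 2 * Y ^ 2 * e'| ≤ 3 * (X ^ 2 + Y ^ 2) * (e + e') := by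
  have product_le : |X * Y| ≤ (X ^ 2 + Y ^ 2) / 2 := by
    rw [abs_mul]
    linarith [two_mul_le_add_sq |X| |Y|, sq_abs X, sq_abs Y]
  have cross_le : |X * Y * δ| ≤ (X ^ 2 + Y ^ 2) / 2 * (e + e') := by
    rw [abs_mul]
    exact mul_le_mul product_le hδ (abs_nonneg δ) (by positivity)
  have ⟨lower, upper⟩ := abs_le.1 cross_le
  have := mul_nonneg (sq_nonneg X) he
  have := mul_nonneg (sq_nonneg X) he'
  have := mul_nonneg (sq_nonneg Y) he
  have := mul_nonneg (sq_nonneg Y) he'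
  exact abs_le.2 ⟨by linarith, by linarith⟩

namespace OrthFrame

theorem exists_diagonals (hN : ∀ z, z ≠ 0 → 0 < N z) (hd : HasOrthDiagonals N)
    (h : OrthFrame N x y) : ∃ u v, OrthFrame N u v ∧
      x = (N (u + v))⁻¹ • (u + v) ∧ y = (N (v - u))⁻¹ • (v - u) := by
  obtain ⟨φ, χ, angles, rfl, rfl⟩ := h.exists_angles hN
  obtain ⟨u, v, φ', χ', frame, angles', polar_add, polar_sub, sum_eq⟩ :=
    exists_orthAngles_diagonals hN hd (φ + χ)
  obtain ⟨rfl, rfl⟩ := angles'.unique hN angles sum_eq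
  exact ⟨u, v, frame, unitDir_eq_inv_smul frame.norm_add_pos polar_add,
    unitDir_eq_inv_smul frame.norm_sub_pos polar_sub⟩

theorem orth_symm (hN : ∀ z, z ≠ 0 → 0 < N z) (hd : HasOrthDiagonals N) (h : OrthFrame N x y) :
    BirkhoffOrthWith N y x := by
  obtain ⟨u, v, frame, rfl, rfl⟩ := h.exists_diagonals hN hd
  have orth := (hd frame.left frame.right frame.orth).smul (-(N (v - u))⁻¹) (N (u + v))⁻¹
  rwa [neg_smul, ← smul_neg, neg_sub] at orth

theorem abs_areaForm_left_le (hN : ∀ z, z ≠ 0 → 0 < N z) (hd : HasOrthDiagonals N)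
    (h : OrthFrame N x y) (z : ℂ) : |ω x z| ≤ ω x y * N z := by
  have le := (h.orth_symm hN hd).abs_areaForm_mul_le z
  rwa [h.right, mul_one, Orientation.areaForm_swap, abs_neg, Complex.orientation.areaForm_swap y,
    abs_neg, abs_of_pos h.pos] at le

theorem areaForm_le_left (h : OrthFrame N x y) (hx' : N x' = 1) : ω x' y ≤ ω x y := by
  simpa only [hx', mul_one] using (le_abs_self _).trans (h.abs_areaForm_le x')

theorem areaForm_le_right (hN : ∀ z, z ≠ 0 → 0 < N z) (hd : HasOrthDiagonals N)
    (h : OrthFrame N x y) (hy' : N y' = 1) : ω x y' ≤ ω x y := by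
  simpa only [hy', mul_one] using (le_abs_self _).trans (h.abs_areaForm_left_le hN hd y')

theorem abs_areaForm_sub_areaForm_le (hN : ∀ z, z ≠ 0 → 0 < N z) (hd : HasOrthDiagonals N)
    (h : OrthFrame N x y) (h' : OrthFrame N x' y') :
    |ω x' y' - ω x y| ≤ ‖x' - x‖ * ‖y' - y‖ := by
  have expand : ω (x' - x) (y' - y) = ω x' y' + ω x y - (ω x' y + ω x y') := by
    simp only [map_sub, LinearMap.sub_apply]
    ring
  have le_norm := (le_abs_self _).trans (Complex.orientation.abs_areaForm_le (x' - x) (y' - y))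
  have left := h.areaForm_le_left h'.left
  have left' := h'.areaForm_le_left h.left
  have right := h.areaForm_le_right hN hd h'.right
  have right' := h'.areaForm_le_right hN hd h.right
  exact abs_sub_le_iff.2 ⟨by linarith, by linarith⟩

theorem areaForm_eq (hN : ∀ z, z ≠ 0 → 0 < N z) (hd : HasOrthDiagonals N)
    (h : OrthFrame N x y) (h' : OrthFrame N x' y') : ω x y = ω x' y' := by
  refine eq_of_abs_sub_le_sq hN (F := fun x y => ω x y) (fun x y h => ⟨1, fun x' y' h' => ?_⟩) h h'
  refine (h.abs_areaForm_sub_areaForm_le hN hd h').trans ?_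
  nlinarith [sq_nonneg (‖x' - x‖), sq_nonneg (‖y' - y‖),
    mul_nonneg (norm_nonneg (x' - x)) (norm_nonneg (y' - y))]

theorem add_mul_sub_eq_two (hN : ∀ z, z ≠ 0 → 0 < N z) (hd : HasOrthDiagonals N)
    (h : OrthFrame N x y) : N (x + y) * N (y - x) = 2 := by
  have add_pos := one_pos.trans_le h.one_le_add
  have sub_pos := one_pos.trans_le h.one_le_sub
  have area_eq := (h.diagonals hd).areaForm_eq hN hd h
  rw [map_smul, map_smul, LinearMap.smul_apply, areaForm_add_sub, smul_eq_mul, smul_eq_mul,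
    inv_mul_eq_div, inv_mul_eq_div, div_div, div_eq_iff (by positivity)] at area_eq
  exact mul_left_cancel₀ h.pos.ne' (by linarith)

-- The diagonals of the diagonal frame are combinations of `x` and `y` with one coefficient equal
-- to `1 / N (x + y) + 1 / N (y - x)`, which therefore bounds their norms from below.
theorem add_eq_sub (hN : ∀ z, z ≠ 0 → 0 < N z) (hd : HasOrthDiagonals N)
    (h : OrthFrame N x y) : N (x + y) = N (y - x) := by
  have product := h.add_mul_sub_eq_two hN hd
  have diag_product := (h.diagonals hd).add_mul_sub_eq_two hN hd
  have add_pos := one_pos.trans_le h.one_le_add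
  have sub_pos := one_pos.trans_le h.one_le_sub
  set a := N (x + y)
  set b := N (y - x)
  have coeff_nonneg : 0 ≤ a⁻¹ + b⁻¹ := by positivity
  have le_add : a⁻¹ + b⁻¹ ≤ N (a⁻¹ • (x + y) + b⁻¹ • (y - x)) := by
    have le := (h.orth_symm hN hd).smul (a⁻¹ + b⁻¹) (a⁻¹ - b⁻¹) 1
    rw [map_smul_eq_mul, h.right, mul_one, Real.norm_of_nonneg coeff_nonneg] at le
    exact le.trans_eq (congrArg N (by module))
  have le_sub : a⁻¹ + b⁻¹ ≤ N (b⁻¹ • (y - x) - a⁻¹ • (x + y)) := by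
    have le := h.orth.smul (-(a⁻¹ + b⁻¹)) (b⁻¹ - a⁻¹) 1
    rw [map_smul_eq_mul, h.left, mul_one, norm_neg, Real.norm_of_nonneg coeff_nonneg] at le
    exact le.trans_eq (congrArg N (by module))
  have sq_le : (a⁻¹ + b⁻¹) * (a⁻¹ + b⁻¹) ≤ 2 :=
    diag_product ▸ mul_le_mul le_add le_sub coeff_nonneg (apply_nonneg N _)
  have coeff_eq : a⁻¹ + b⁻¹ = (a + b) / 2 := by
    rw [inv_add_inv add_pos.ne' sub_pos.ne', product]
  rw [coeff_eq] at sq_le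
  have sq_nonpos : (a - b) ^ 2 ≤ 0 := by linarith
  exact sub_eq_zero.1 (sq_nonpos_iff _ |>.1 sq_nonpos)

theorem sub_eq_sqrt_two (hN : ∀ z, z ≠ 0 → 0 < N z) (hd : HasOrthDiagonals N)
    (h : OrthFrame N x y) : N (y - x) = √2 := by
  rw [← h.add_mul_sub_eq_two hN hd, h.add_eq_sub hN hd, Real.sqrt_mul_self (apply_nonneg N _)]

theorem areaForm_add_sub_le (hN : ∀ z, z ≠ 0 → 0 < N z) (hd : HasOrthDiagonals N)
    (h : OrthFrame N x y) (h' : OrthFrame N x' y') : ω (x' + y') (y - x) ≤ 2 * ω x y := by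
  have le := (le_abs_self _).trans ((h.diagonals hd).abs_areaForm_le (x' + y'))
  rw [(h.diagonals hd).areaForm_eq hN hd h, map_smul, smul_eq_mul, h'.add_eq_sub hN hd,
    h.sub_eq_sqrt_two hN hd, h'.sub_eq_sqrt_two hN hd,
    inv_mul_le_iff₀ (Real.sqrt_pos.2 two_pos)] at le
  linear_combination le + ω x y * Real.mul_self_sqrt zero_le_two

theorem abs_areaForm_sub_areaForm_self_le (hN : ∀ z, z ≠ 0 → 0 < N z) (hd : HasOrthDiagonals N)
    (h : OrthFrame N x y) (h' : OrthFrame N x' y') :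
    |ω x x' - ω y y'| ≤ ω (x' - x) (y' - y) := by
  have le := h.areaForm_add_sub_le hN hd h'
  have le' := h'.areaForm_add_sub_le hN hd h
  have area_eq := h.areaForm_eq hN hd h'
  simp only [map_sub, map_add, LinearMap.sub_apply, LinearMap.add_apply] at le le' ⊢
  rw [Complex.orientation.areaForm_swap x' x, Complex.orientation.areaForm_swap y' y,
    Complex.orientation.areaForm_swap y' x] at le
  rw [Complex.orientation.areaForm_swap y x'] at le'
  exact abs_sub_le_iff.2 ⟨by linarith, by linarith⟩

theorem abs_sq_areaForm_add_sub_le (hN : ∀ z, z ≠ 0 → 0 < N z) (hd : HasOrthDiagonals N)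
    (h : OrthFrame N x y) (h' : OrthFrame N x' y') (z : ℂ) :
    ω x y * |ω x' z ^ 2 + ω y' z ^ 2 - (ω x z ^ 2 + ω y z ^ 2)| ≤
      (3 * (ω x z ^ 2 + ω y z ^ 2) + ω x y * ‖z‖ ^ 2) * (‖x' - x‖ + ‖y' - y‖) ^ 2 := by
  have area_pos := h.pos
  have diagonal_le := h.abs_areaForm_sub_areaForm_self_le hN hd h'
  have left_nonneg := sub_nonneg.2 (h.areaForm_le_left h'.left)
  have right_nonneg := sub_nonneg.2 (h.areaForm_le_right hN hd h'.right)
  have area_sub : ω (x' - x) (y' - y) = (ω x y - ω x' y) + (ω x y - ω x y') := by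
    simp only [map_sub, LinearMap.sub_apply]
    linarith [h.areaForm_eq hN hd h']
  have area_le := (le_abs_self _).trans (Complex.orientation.abs_areaForm_le (x' - x) (y' - y))
  have sq_le : ∀ w, ω w z ^ 2 ≤ ‖w‖ ^ 2 * ‖z‖ ^ 2 := fun w => by
    rw [← mul_pow]
    exact sq_le_sq.2 ((Complex.orientation.abs_areaForm_le w z).trans (le_abs_self _))
  have x_le := sq_le (x' - x)
  have y_le := sq_le (y' - y)
  have dx_nonneg := norm_nonneg (x' - x)
  have dy_nonneg := norm_nonneg (y' - y)
  rw [area_sub] at diagonal_le area_le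
  rw [← abs_of_pos h.pos, ← abs_mul, areaForm_mul_sq_add_sq_sub, abs_of_pos h.pos]
  calc _ ≤ 3 * (ω x z ^ 2 + ω y z ^ 2) * ((ω x y - ω x' y) + (ω x y - ω x y')) +
        ω x y * (ω (x' - x) z ^ 2 + ω (y' - y) z ^ 2) := by
        refine (abs_add_le _ _).trans (add_le_add ?_ (abs_of_nonneg (by positivity)).le)
        exact abs_two_mul_sub_sub_le left_nonneg right_nonneg diagonal_le
    _ ≤ 3 * (ω x z ^ 2 + ω y z ^ 2) * (‖x' - x‖ * ‖y' - y‖) +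
        ω x y * (‖x' - x‖ ^ 2 * ‖z‖ ^ 2 + ‖y' - y‖ ^ 2 * ‖z‖ ^ 2) := by
        gcongr
    _ ≤ 3 * (ω x z ^ 2 + ω y z ^ 2) * (‖x' - x‖ + ‖y' - y‖) ^ 2 +
        ω x y * (‖z‖ ^ 2 * (‖x' - x‖ + ‖y' - y‖) ^ 2) := by
        rw [← add_mul, mul_comm (‖z‖ ^ 2)]
        gcongr <;> nlinarith
    _ = _ := by ring

theorem sq_areaForm_add_sq_eq (hN : ∀ z, z ≠ 0 → 0 < N z) (hd : HasOrthDiagonals N)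
    (h : OrthFrame N x y) (h' : OrthFrame N x' y') (z : ℂ) :
    ω x z ^ 2 + ω y z ^ 2 = ω x' z ^ 2 + ω y' z ^ 2 := by
  refine eq_of_abs_sub_le_sq hN (F := fun x y => ω x z ^ 2 + ω y z ^ 2)
    (fun x y h => ⟨(3 * (ω x z ^ 2 + ω y z ^ 2) + ω x y * ‖z‖ ^ 2) / ω x y, fun x' y' h' => ?_⟩)
    h h'
  rw [div_mul_eq_mul_div, le_div_iff₀' h.pos]
  exact h.abs_sq_areaForm_add_sub_le hN hd h' z

theorem sq_mul_sq_eq (hN : ∀ z, z ≠ 0 → 0 < N z) (hd : HasOrthDiagonals N)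
    (h : OrthFrame N x y) (z : ℂ) :
    ω x y ^ 2 * N z ^ 2 = ω x z ^ 2 + ω y z ^ 2 := by
  rcases eq_or_ne z 0 with rfl | hz
  · simp
  have Nz_pos := hN z hz
  obtain ⟨v, frame⟩ := exists_orthFrame_left hN hz
  rw [h.areaForm_eq hN hd frame, h.sq_areaForm_add_sq_eq hN hd frame, map_smul,
    LinearMap.smul_apply, LinearMap.smul_apply, Orientation.areaForm_apply_self,
    Complex.orientation.areaForm_swap v z, smul_zero, smul_eq_mul]
  field_simp
  ring

end OrthFrame

theorem HasOrthDiagonals.parallelogram (hN : ∀ z, z ≠ 0 → 0 < N z) (hd : HasOrthDiagonals N)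
    (z w : ℂ) : N (z + w) ^ 2 + N (z - w) ^ 2 = 2 * (N z ^ 2 + N w ^ 2) := by
  obtain ⟨y, frame⟩ := exists_orthFrame_left hN one_ne_zero
  have form := frame.sq_mul_sq_eq hN hd
  have form_add := form (z + w)
  have form_sub := form (z - w)
  simp only [map_add (ω _), map_sub (ω _)] at form_add form_sub
  refine mul_left_cancel₀ (pow_pos frame.pos 2).ne' ?_
  linear_combination form_add + form_sub - 2 * form z - 2 * form w

end Plane

theorem HasOrthDiagonals.comp {E F : Type*} [AddCommGroup E] [Module ℝ E] [AddCommGroup F]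
    [Module ℝ F] {p : Seminorm ℝ E} (hd : HasOrthDiagonals p) (f : F →ₗ[ℝ] E) :
    HasOrthDiagonals (p.comp f) := by
  intro x y hx hy hxy t
  have orth : BirkhoffOrthWith p (f x) (f y) := fun s => by
    rw [← map_smul, ← map_add]
    exact hxy s
  simpa only [Seminorm.comp_apply, map_sub, map_add, map_smul] using hd hx hy orth t

section NormedSpace

variable {X : Type*} [NormedAddCommGroup X] [NormedSpace ℝ X] {x y : X}

/-- The linear parametrization `a + b * I ↦ a • v + b • w` of the span of `v` and `w`. -/
noncomputable def planeMap (v w : X) : ℂ →ₗ[ℝ] X :=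
  reLm.smulRight v + imLm.smulRight w

theorem planeMap_injective {v w : X} (h : LinearIndependent ℝ ![v, w]) :
    Function.Injective (planeMap v w) :=
  (injective_iff_map_eq_zero _).2 fun z hz =>
    have coords := LinearIndependent.pair_iff.1 h z.re z.im hz
    Complex.ext coords.1 coords.2

-- Rescaling `x` and `y` by `1 + r` and `1 - r` turns the difference of the normalized vectors
-- into `x - y` and the difference of the vectors into `x - y + r • (x + y)`.
theorem hasOrthDiagonals_of_dunklWilliams
    (h : ∀ x y : X, x ≠ 0 → y ≠ 0 → BirkhoffOrthogonal x y →
      ‖‖x‖⁻¹ • x - ‖y‖⁻¹ • y‖ ≤ 2 * ‖x - y‖ / (‖x‖ + ‖y‖)) :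
    HasOrthDiagonals (normSeminorm ℝ X) := by
  intro x y (hx : ‖x‖ = 1) (hy : ‖y‖ = 1) hxy
  refine .of_forall_one_sub_sq_mul_le fun r hr => ?_
  have ⟨neg_one_lt, lt_one⟩ := abs_lt.1 hr
  have add_pos : 0 < 1 + r := by linarith
  have sub_pos : 0 < 1 - r := by linarith
  have x_ne_zero : x ≠ 0 := norm_ne_zero_iff.1 (hx ▸ one_ne_zero)
  have y_ne_zero : y ≠ 0 := norm_ne_zero_iff.1 (hy ▸ one_ne_zero)
  have le := h _ _ (smul_ne_zero add_pos.ne' x_ne_zero) (smul_ne_zero sub_pos.ne' y_ne_zero)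
    (hxy.smul (1 + r) (1 - r))
  rw [norm_smul, norm_smul, hx, hy, Real.norm_of_nonneg add_pos.le, Real.norm_of_nonneg sub_pos.le,
    mul_one, mul_one, inv_smul_smul₀ add_pos.ne', inv_smul_smul₀ sub_pos.ne',
    show 1 + r + (1 - r) = 2 by ring, mul_div_cancel_left₀ _ two_ne_zero] at le
  calc (1 - r ^ 2) * ‖x - y‖ ≤ ‖x - y‖ :=
        mul_le_of_le_one_left (norm_nonneg _) (sub_le_self 1 (sq_nonneg r))
    _ ≤ ‖(1 + r) • x - (1 - r) • y‖ := le
    _ = ‖x - y + r • (x + y)‖ := by congr 1; module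

theorem HasOrthDiagonals.norm_parallelogram (hd : HasOrthDiagonals (normSeminorm ℝ X)) (v w : X) :
    ‖v + w‖ * ‖v + w‖ + ‖v - w‖ * ‖v - w‖ = 2 * (‖v‖ * ‖v‖ + ‖w‖ * ‖w‖) := by
  simp only [← sq]
  by_cases independent : LinearIndependent ℝ ![v, w]
  · have pos : ∀ z, z ≠ 0 → 0 < (normSeminorm ℝ X).comp (planeMap v w) z := fun z hz =>
      norm_pos_iff.2 ((map_ne_zero_iff _ (planeMap_injective independent)).2 hz)
    have law := (hd.comp (planeMap v w)).parallelogram pos 1 I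
    simpa [planeMap, sub_eq_add_neg] using law
  · rcases eq_or_ne v 0 with rfl | hv
    · simp [two_mul]
    · obtain ⟨c, rfl⟩ : ∃ c : ℝ, c • v = w := by
        by_contra! hc
        exact independent ((LinearIndependent.pair_iff' hv).2 hc)
      have add_eq : v + c • v = (1 + c) • v := by module
      have sub_eq : v - c • v = (1 - c) • v := by module
      simp only [add_eq, sub_eq, norm_smul, mul_pow, Real.norm_eq_abs, sq_abs]
      ring

theorem IsInnerProductSpace.dunklWilliams (hX : IsInnerProductSpace X) (hx : x ≠ 0)
    (hy : y ≠ 0) : ‖‖x‖⁻¹ • x - ‖y‖⁻¹ • y‖ ≤ 2 * ‖x - y‖ / (‖x‖ + ‖y‖) := by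
  obtain ⟨I, rfl⟩ := hX
  have x_pos := norm_pos_iff.2 hx
  have y_pos := norm_pos_iff.2 hy
  rw [le_div_iff₀ (by positivity)]
  refine le_of_sq_le_sq ?_ (by positivity)
  rw [mul_pow, mul_pow, norm_sub_sq_real, norm_sub_sq_real, norm_smul, norm_smul,
    real_inner_smul_left, real_inner_smul_right, norm_inv, norm_inv, norm_norm, norm_norm,
    inv_mul_cancel₀ x_pos.ne', inv_mul_cancel₀ y_pos.ne']
  have cauchy_schwarz := (abs_le.1 (abs_real_inner_le_norm x y)).1
  set i := inner ℝ x y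
  set c := ‖x‖⁻¹ * (‖y‖⁻¹ * i) with hc
  have inner_eq : i = c * (‖x‖ * ‖y‖) := by
    rw [hc]
    field_simp
  rw [inner_eq] at cauchy_schwarz ⊢
  have neg_one_le : -1 ≤ c := by
    refine le_of_mul_le_mul_right ?_ (mul_pos x_pos y_pos)
    rwa [neg_one_mul]
  linarith [mul_nonneg (neg_le_iff_add_nonneg'.1 neg_one_le) (sq_nonneg (‖x‖ - ‖y‖))]

theorem isInnerProductSpace_iff_dunklWilliams : IsInnerProductSpace X ↔
    ∀ x y : X, x ≠ 0 → y ≠ 0 → BirkhoffOrthogonal x y →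
      ‖‖x‖⁻¹ • x - ‖y‖⁻¹ • y‖ ≤ 2 * ‖x - y‖ / (‖x‖ + ‖y‖) :=
  ⟨fun hX _ _ hx hy _ => hX.dunklWilliams hx hy, fun h =>
    ⟨.ofNorm (𝕜 := ℝ) (hasOrthDiagonals_of_dunklWilliams h).norm_parallelogram, rfl⟩⟩

theorem BirkhoffOrthogonal.norm_sub_pos (hx : x ≠ 0) (h : BirkhoffOrthogonal x y) :
    0 < ‖x - y‖ := by
  have le := h (-1)
  rw [neg_one_smul, ← sub_eq_add_neg] at le
  exact (norm_pos_iff.2 hx).trans_le le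

theorem dunklWilliamsQuotient_le_two_iff (hx : x ≠ 0) (h : BirkhoffOrthogonal x y) :
    dunklWilliamsQuotient x y ≤ 2 ↔
      ‖‖x‖⁻¹ • x - ‖y‖⁻¹ • y‖ ≤ 2 * ‖x - y‖ / (‖x‖ + ‖y‖) := by
  have sub_pos := h.norm_sub_pos hx
  have add_pos : 0 < ‖x‖ + ‖y‖ := add_pos_of_pos_of_nonneg (norm_pos_iff.2 hx) (norm_nonneg y)
  rw [dunklWilliamsQuotient, le_div_iff₀ add_pos, div_mul_eq_mul_div, div_le_iff₀ sub_pos,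
    mul_comm (‖x‖ + ‖y‖)]

theorem isInnerProductSpace_iff_DWB_le_two : IsInnerProductSpace X ↔ DWB X ≤ 2 := by
  rw [isInnerProductSpace_iff_dunklWilliams, DWB, sSup_le_iff]
  constructor
  · rintro h _ ⟨x, y, hx, hy, hxy, rfl⟩
    exact EReal.coe_le_coe_iff.2 ((dunklWilliamsQuotient_le_two_iff hx hxy).2 (h x y hx hy hxy))
  · intro h x y hx hy hxy
    exact (dunklWilliamsQuotient_le_two_iff hx hxy).1
      (EReal.coe_le_coe_iff.1 (h _ ⟨x, y, hx, hy, hxy, rfl⟩))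

theorem BirkhoffOrthogonal.dunklWilliamsQuotient_eq_two (hx : ‖x‖ = 1) (hy : ‖y‖ = 1)
    (h : BirkhoffOrthogonal x y) : dunklWilliamsQuotient x y = 2 := by
  have sub_pos := h.norm_sub_pos (norm_ne_zero_iff.1 (hx ▸ one_ne_zero))
  rw [dunklWilliamsQuotient, hx, hy, inv_one, one_smul, one_smul, div_mul_cancel₀ _ sub_pos.ne',
    one_add_one_eq_two]

theorem exists_birkhoffOrthogonal_norm_eq_one (hr : 2 ≤ Module.rank ℝ X) :
    ∃ x y : X, ‖x‖ = 1 ∧ ‖y‖ = 1 ∧ BirkhoffOrthogonal x y := by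
  have one_lt_rank : 1 < Module.rank ℝ X := lt_of_lt_of_le (by norm_num) hr
  obtain ⟨v, hv⟩ := rank_pos_iff_exists_ne_zero.1 (zero_lt_one.trans one_lt_rank)
  obtain ⟨w, hw⟩ := exists_linearIndependent_pair_of_one_lt_rank one_lt_rank hv
  obtain ⟨f, norm_f, f_v⟩ := exists_dual_vector ℝ v (norm_ne_zero_iff.2 hv)
  have f_v : f v = ‖v‖ := f_v
  have v_pos : 0 < ‖v‖ := norm_pos_iff.2 hv
  have orth : ∀ u, f u = 0 → BirkhoffOrthogonal v u := fun u hu t =>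
    calc ‖v‖ = f (v + t • u) := by rw [map_add, map_smul, hu, smul_zero, add_zero, f_v]
      _ ≤ ‖v + t • u‖ := (le_abs_self _).trans <| by
        simpa only [norm_f, one_mul, Real.norm_eq_abs] using f.le_opNorm (v + t • u)
  set u := w - (f w / ‖v‖) • v with hu
  have f_u : f u = 0 := by
    rw [hu, map_sub, map_smul, f_v, smul_eq_mul, div_mul_cancel₀ _ v_pos.ne', sub_self]
  have u_ne_zero : u ≠ 0 := fun h0 =>
    (LinearIndependent.pair_iff' hv).1 hw _ (sub_eq_zero.1 h0).symm
  exact ⟨‖v‖⁻¹ • v, ‖u‖⁻¹ • u, norm_smul_inv_norm hv, norm_smul_inv_norm u_ne_zero,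
    BirkhoffOrthWith.smul (p := normSeminorm ℝ X) (orth u f_u) _ _⟩

theorem two_le_DWB (hr : 2 ≤ Module.rank ℝ X) : 2 ≤ DWB X := by
  obtain ⟨x, y, hx, hy, hxy⟩ := exists_birkhoffOrthogonal_norm_eq_one hr
  refine le_sSup ⟨x, y, norm_ne_zero_iff.1 (hx ▸ one_ne_zero),
    norm_ne_zero_iff.1 (hy ▸ one_ne_zero), hxy, ?_⟩
  rw [hxy.dunklWilliamsQuotient_eq_two hx hy]
  rfl

end NormedSpace

theorem proposition3 (X : Type*) [NormedAddCommGroup X] [NormedSpace ℝ X] :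
    (IsInnerProductSpace X ↔
      ∀ x y : X, x ≠ 0 → y ≠ 0 → BirkhoffOrthogonal x y →
        ‖‖x‖⁻¹ • x - ‖y‖⁻¹ • y‖ ≤ 2 * ‖x - y‖ / (‖x‖ + ‖y‖)) ∧
    (2 ≤ Module.rank ℝ X → (IsInnerProductSpace X ↔ DWB X = 2)) :=
  ⟨isInnerProductSpace_iff_dunklWilliams, fun hr => isInnerProductSpace_iff_DWB_le_two.trans
    ⟨fun h => h.antisymm (two_le_DWB hr), le_of_eq⟩⟩
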